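/- Let $\mathcal{R}$ be a first-order structure on $\mathbb{R}$ expanding the ordered additive group $(\mathbb{R},<,+)$; "definable" means definable in $\mathcal{R}$, possibly with parameters. An $\omega$-orderable set is a definable set $D\subseteq\mathbb{R}$ that is either finite or admits a definable ordering of order type $\omega$; it is called dense if it is dense in some nonempty open interval of $\mathbb{R}$. Say that $\mathcal{R}$ is of type B if it defines a dense $\omega$-orderable set, but there are $k$ and a compact subset of $\mathbb{R}^k$ that is not definable in $\mathcal{R}$. For a nonempty bounded open interval $I\subseteq\mathbb{R}$, a function $f:I\to\mathbb{R}$ is called repetitious if for every nonempty open subinterval $J\subseteq I$ there are $\delta>0$ and $x,y\in J$ such that $\delta<y-x$ and, for all $0\le\epsilon<\delta$, the points $x+\epsilon,\,y+\epsilon$ lie in $I$ and $$f(x+\epsilon)-f(x)=f(y+\epsilon)-f(y).$$ Theorem D. Suppose $\mathcal{R}$ is of type B. Then for every nonempty bounded open interval $I\subseteq\mathbb{R}$, every continuous definable function $f:I\to\mathbb{R}$ is repetitious. -/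

import Mathlib

universe u v

namespace RealExpansion

/-- The function symbols of the language `{<, +}`: one binary symbol. -/
inductive AddLtFunc : ℕ → Type
  | add : AddLtFunc 2

/-- The relation symbols of the language `{<, +}`: one binary symbol. -/
inductive AddLtRel : ℕ → Type
  | lt : AddLtRel 2

/-- The language `{<, +}` of ordered additive groups. -/
def addLt : FirstOrder.Language.{0, 0} where
  Functions := AddLtFunc
  Relations := AddLtRel

/-- The ordered additive group of real numbers `(ℝ, <, +)`. -/
instance realAddLtStructure : addLt.Structure ℝ where
  funMap := fun {_} s => match s with
    | AddLtFunc.add => fun v => v 0 + v 1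
  RelMap := fun {_} s => match s with
    | AddLtRel.lt => fun v => v 0 < v 1

/-- A subset of `ℝ^k` is definable, possibly with (arbitrary real) parameters. -/
def DefinableSet (L : FirstOrder.Language.{u, v}) [L.Structure ℝ] {k : ℕ} (X : Set (Fin k → ℝ)) : Prop :=
  (Set.univ : Set ℝ).Definable L X

/-- The function `f`, considered on the domain `I` only, is definable: its graph over `I` is. -/
def DefinableFunOn (L : FirstOrder.Language.{u, v}) [L.Structure ℝ] (f : ℝ → ℝ) (I : Set ℝ) : Prop :=
  DefinableSet L {p : Fin 2 → ℝ | p 0 ∈ I ∧ p 1 = f (p 0)}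

/-- `D ⊆ ℝ` is an `ω`-orderable set: it is definable, and it is either finite or admits a
definable ordering with order type `ω`. Only the values of `r` on `D × D` matter. -/
def OmegaOrderable (L : FirstOrder.Language.{u, v}) [L.Structure ℝ] (D : Set ℝ) : Prop :=
  DefinableSet L {p : Fin 1 → ℝ | p 0 ∈ D} ∧
    (D.Finite ∨ ∃ r : ℝ → ℝ → Prop,
      DefinableSet L {p : Fin 2 → ℝ | p 0 ∈ D ∧ p 1 ∈ D ∧ r (p 0) (p 1)} ∧
      Nonempty ((fun x y : D => r x y) ≃r ((· < ·) : ℕ → ℕ → Prop)))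

/-- `D` is dense in some nonempty open interval. -/
def DenseInSomeInterval (D : Set ℝ) : Prop :=
  ∃ a b : ℝ, a < b ∧ Set.Ioo a b ⊆ closure D

/-- Type B: some dense `ω`-orderable set is definable, but some compact subset of some `ℝ^k` is
not definable. -/
def IsTypeB (L : FirstOrder.Language.{u, v}) [L.Structure ℝ] : Prop :=
  (∃ D : Set ℝ, OmegaOrderable L D ∧ DenseInSomeInterval D) ∧
    ∃ (k : ℕ) (X : Set (Fin k → ℝ)), IsCompact X ∧ ¬ DefinableSet L X

/-- `f` is repetitious on the open interval `I = (a, b)`. The equation refers to values of `f` at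
points of `I` only. -/
def Repetitious (f : ℝ → ℝ) (a b : ℝ) : Prop :=
  ∀ c d : ℝ, c < d → Set.Ioo c d ⊆ Set.Ioo a b →
    ∃ δ > 0, ∃ x ∈ Set.Ioo c d, ∃ y ∈ Set.Ioo c d, δ < y - x ∧
      ∀ ε : ℝ, 0 ≤ ε → ε < δ →
        x + ε ∈ Set.Ioo a b ∧ y + ε ∈ Set.Ioo a b ∧ f (x + ε) - f x = f (y + ε) - f y

end RealExpansion

/-! If `f` is not repetitious, then on some interval any two distinct points have increments of `f`
that differ for arbitrarily small `ε`. A dense `ω`-orderable set supplies, in a subinterval, an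
injective dense sequence `q` whose enumeration order is definable. These two ingredients define
every compact set, contradicting type B.

The order of `q` turns a real `x` into the sequence of its records, the best approximations from
below, and any other coding real into a small positive number at each record, its offset. Nested
intervals produce finitely many reals whose offsets at successive records lie in prescribed sets,
provided these have interior points with arbitrarily small positive coordinates
(`exists_coding_reals`). Offsets alone only give approximate data; `f` makes the data exact. A
narrow open condition on an increment of `f` can hold at `q p` and fail at another chosen point
(`exists_fits`). A block of consecutive records rules out `q i` for every `i < p`, so `q p` is the
first point meeting all constraints of the block (`exists_encoding`). Finitely many parameters thus
store a whole sequence of tuples, and a nonempty compact set is the cluster set of such a sequence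
up to an affine map (`exists_cluster_sequence`). -/

open FirstOrder Set

namespace RealExpansion

/-! ### Closure properties of definable predicates. -/

section Definability

variable (L : FirstOrder.Language.{u, v}) [L.Structure ℝ]

/-- A predicate on real tuples indexed by `α` is definable with real parameters. -/
def DPred {α : Type} (P : (α → ℝ) → Prop) : Prop :=
  (Set.univ : Set ℝ).Definable L {w | P w}

/-- A real-valued function of tuples indexed by `α` is given by a term with real parameters. -/
def DTerm {α : Type} (t : (α → ℝ) → ℝ) : Prop :=
  ∃ τ : L[[(Set.univ : Set ℝ)]].Term α, ∀ w, τ.realize w = t w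

variable {L} {α β : Type}

theorem DPred.and {P Q : (α → ℝ) → Prop} (hP : DPred L P) (hQ : DPred L Q) :
    DPred L fun w => P w ∧ Q w :=
  Set.Definable.inter hP hQ

theorem DPred.or {P Q : (α → ℝ) → Prop} (hP : DPred L P) (hQ : DPred L Q) :
    DPred L fun w => P w ∨ Q w :=
  Set.Definable.union hP hQ

theorem DPred.not {P : (α → ℝ) → Prop} (hP : DPred L P) : DPred L fun w => ¬ P w :=
  Set.Definable.compl hP

theorem DPred.imp {P Q : (α → ℝ) → Prop} (hP : DPred L P) (hQ : DPred L Q) :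
    DPred L fun w => P w → Q w := by
  simpa only [imp_iff_not_or] using hP.not.or hQ

theorem DPred.forall_finite {ι : Type} [Finite ι] {P : ι → (α → ℝ) → Prop}
    (h : ∀ i, DPred L (P i)) : DPred L fun w => ∀ i, P i w := by
  classical
  cases nonempty_fintype ι
  have := Set.definable_biInter_finset (A := (Set.univ : Set ℝ)) (L := L)
    (f := fun i => {w | P i w}) h Finset.univ
  unfold DPred
  convert this using 1
  ext w
  simp

theorem DPred.subst {P : (β → ℝ) → Prop} (hP : DPred L P) {t : β → (α → ℝ) → ℝ}
    (ht : ∀ b, DTerm L (t b)) : DPred L fun w => P fun b => t b w := by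
  obtain ⟨φ, hφ⟩ := hP
  choose τ hτ using ht
  refine ⟨φ.subst τ, ?_⟩
  ext w
  have h := Set.ext_iff.1 hφ fun b => t b w
  simp only [Set.mem_ofPred_eq] at h ⊢
  rw [h, FirstOrder.Language.Formula.Realize, FirstOrder.Language.Formula.Realize,
    FirstOrder.Language.BoundedFormula.realize_subst]
  simp only [hτ]

theorem DPred.ex {P : (α → ℝ) → ℝ → Prop}
    (h : DPred L fun w : Option α → ℝ => P (fun a => w (some a)) (w none)) :
    DPred L fun w => ∃ y, P w y := by
  obtain ⟨φ, hφ⟩ := h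
  refine ⟨FirstOrder.Language.Formula.iExs Unit
    (φ.relabel (fun o : Option α => o.elim (Sum.inr ()) Sum.inl)), ?_⟩
  ext w
  simp only [Set.mem_ofPred_eq, FirstOrder.Language.Formula.realize_iExs,
    FirstOrder.Language.Formula.realize_relabel]
  constructor
  · rintro ⟨y, hy⟩
    refine ⟨fun _ => y, ?_⟩
    have := (Set.ext_iff.1 hφ fun o => o.elim y w).1 hy
    change φ.Realize _ at this
    convert this using 1
    ext o
    cases o <;> rfl
  · rintro ⟨y, hy⟩
    refine ⟨y (), ?_⟩
    refine (Set.ext_iff.1 hφ fun o => o.elim (y ()) w).2 ?_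
    change φ.Realize _
    convert hy using 1
    ext o
    cases o <;> rfl

theorem DPred.all {P : (α → ℝ) → ℝ → Prop}
    (h : DPred L fun w : Option α → ℝ => P (fun a => w (some a)) (w none)) :
    DPred L fun w => ∀ y, P w y := by
  have : DPred L fun w => ¬ ∃ y, ¬ P w y := DPred.not (DPred.ex (P := fun w y => ¬ P w y) h.not)
  simpa only [not_exists, not_not] using this

theorem DTerm.var (a : α) : DTerm L fun w => w a :=
  ⟨FirstOrder.Language.var a, fun _ => rfl⟩

theorem DTerm.const (c : ℝ) : DTerm L fun _ : α → ℝ => c :=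
  ⟨FirstOrder.Language.Constants.term (L.con (⟨c, trivial⟩ : (Set.univ : Set ℝ))), fun w => by
    simp⟩

theorem DTerm.add (φ : addLt.LHom L) [φ.IsExpansionOn ℝ] {t t' : (α → ℝ) → ℝ} (ht : DTerm L t) (ht' : DTerm L t') :
    DTerm L fun w => t w + t' w := by
  obtain ⟨τ, hτ⟩ := ht
  obtain ⟨τ', hτ'⟩ := ht'
  have hadd : ∀ x y : ℝ, Language.Structure.funMap
      (φ.onFunction (AddLtFunc.add : addLt.Functions 2)) ![x, y] = x + y := fun x y =>
    (FirstOrder.Language.LHom.map_onFunction φ (M := ℝ)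
      (AddLtFunc.add : addLt.Functions 2) ![x, y]).trans rfl
  refine ⟨FirstOrder.Language.Functions.apply₂
    ((L.lhomWithConstants (Set.univ : Set ℝ)).onFunction
      (φ.onFunction (AddLtFunc.add : addLt.Functions 2))) τ τ', fun w => ?_⟩
  rw [FirstOrder.Language.Term.realize_functions_apply₂,
    FirstOrder.Language.LHom.map_onFunction, hτ, hτ', hadd]

theorem DTerm.nsmul (φ : addLt.LHom L) [φ.IsExpansionOn ℝ] {t : (α → ℝ) → ℝ} (ht : DTerm L t)
    (n : ℕ) : DTerm L fun w => n • t w := by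
  induction n with
  | zero => simpa only [zero_smul] using DTerm.const (L := L) 0
  | succ n ih => simpa only [succ_nsmul] using DTerm.add φ ih ht

theorem DPred.lt (φ : addLt.LHom L) [φ.IsExpansionOn ℝ] {t t' : (α → ℝ) → ℝ} (ht : DTerm L t)
    (ht' : DTerm L t') : DPred L fun w => t w < t' w := by
  obtain ⟨τ, hτ⟩ := ht
  obtain ⟨τ', hτ'⟩ := ht'
  have hlt : ∀ x y : ℝ, Language.Structure.RelMap
      (φ.onRelation (AddLtRel.lt : addLt.Relations 2)) ![x, y] ↔ x < y := fun x y =>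
    iff_of_eq ((FirstOrder.Language.LHom.map_onRelation φ (M := ℝ)
      (AddLtRel.lt : addLt.Relations 2) ![x, y]).trans rfl)
  refine ⟨FirstOrder.Language.Relations.formula₂
    ((L.lhomWithConstants (Set.univ : Set ℝ)).onRelation
      (φ.onRelation (AddLtRel.lt : addLt.Relations 2))) τ τ', ?_⟩
  ext w
  simp only [Set.mem_ofPred_eq]
  rw [FirstOrder.Language.Formula.realize_rel₂,
    FirstOrder.Language.LHom.map_onRelation, hτ, hτ', hlt]

theorem DPred.le (φ : addLt.LHom L) [φ.IsExpansionOn ℝ] {t t' : (α → ℝ) → ℝ} (ht : DTerm L t)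
    (ht' : DTerm L t') : DPred L fun w => t w ≤ t' w := by
  simpa only [not_lt] using (DPred.lt φ ht' ht).not

/-- Together with `DPred.rel₂`, this reduces definability of a relation at terms to definability in
its bare variables. -/
theorem DPred.rel₁ {R : ℝ → Prop} (hR : DPred L fun w : Fin 1 → ℝ => R (w 0))
    {t : (α → ℝ) → ℝ} (ht : DTerm L t) : DPred L fun w => R (t w) :=
  hR.subst (t := fun _ => t) fun _ => ht

theorem DPred.rel₂ {R : ℝ → ℝ → Prop} (hR : DPred L fun w : Fin 2 → ℝ => R (w 0) (w 1))
    {t t' : (α → ℝ) → ℝ} (ht : DTerm L t) (ht' : DTerm L t') :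
    DPred L fun w => R (t w) (t' w) :=
  hR.subst (t := ![t, t']) fun i => by fin_cases i <;> assumption

end Definability

/-! ### Reals with prescribed approximation behaviour. -/

section Coding

open Filter Topology

/-- Among `q 0, …, q n`, the point `q m` is the closest one strictly below `y`. -/
def BestBelow (q : ℕ → ℝ) (y : ℝ) (n m : ℕ) : Prop :=
  m ≤ n ∧ q m < y ∧ ∀ i ≤ n, q i < y → q i ≤ q m

/-- Finitely many points leave a gap to the right of `z`; hence enumerated points close enough to
`z` on that side have large index. -/
theorem exists_gap_right (q : ℕ → ℝ) (z : ℝ) (N : ℕ) :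
    ∃ γ > 0, ∀ i < N, q i ∉ Ioo z (z + γ) := by
  induction N with
  | zero => exact ⟨1, one_pos, fun i hi => absurd hi (Nat.not_lt_zero i)⟩
  | succ N ih =>
    obtain ⟨γ, hγ, h⟩ := ih
    by_cases hz : z < q N
    · refine ⟨min γ (q N - z), lt_min hγ (sub_pos.2 hz), fun i hi hmem => ?_⟩
      rcases Nat.lt_succ_iff_lt_or_eq.1 hi with hi | rfl
      · exact h i hi ⟨hmem.1, hmem.2.trans_le (by gcongr; exact min_le_left _ _)⟩
      · have := min_le_right γ (q i - z)
        linarith [hmem.2]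
    · refine ⟨γ, hγ, fun i hi hmem => ?_⟩
      rcases Nat.lt_succ_iff_lt_or_eq.1 hi with hi | rfl
      · exact h i hi hmem
      · exact hz hmem.1

/-- Finitely many nested choices of reals: the first real lies in `(q n, q n + β)`, the others lie
in the intervals `(l i, r i)`. -/
structure CodingState (ι : Type) where
  /-- the index of the last best approximation from below of the first real -/
  n : ℕ
  /-- the length of the interval available for the first real -/
  β : ℝ
  /-- the left end points -/
  l : ι → ℝ
  /-- the right end points -/
  r : ι → ℝ

/-- The intervals of the state are nonempty subintervals of `(c, d)`. -/
def CodingState.Valid {ι : Type} (q : ℕ → ℝ) (c d : ℝ) (S : CodingState ι) : Prop :=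
  0 < S.β ∧ q S.n + S.β ≤ d ∧ ∀ i, c ≤ S.l i ∧ S.l i < S.r i ∧ S.r i ≤ d

/-- The state `T` refines `S`, its index is the next best approximation of the first real, and at
this index the distances of the other reals to their best approximations form a tuple in `Q`. -/
def CodingState.Step {ι : Type} (q : ℕ → ℝ) (Q : Set (ι → ℝ)) (S T : CodingState ι) : Prop :=
  S.n < T.n ∧ q S.n < q T.n ∧ q T.n + T.β < q S.n + S.β ∧
    (∀ j < T.n, q j ∉ Ioo (q S.n) (q T.n + T.β)) ∧
    (∀ i, S.l i < T.l i ∧ T.r i < S.r i) ∧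
    ∃ m : ι → ℕ, ∀ y : ι → ℝ, (∀ i, y i ∈ Ioo (T.l i) (T.r i)) →
      (∀ i, BestBelow q (y i) T.n (m i)) ∧ (fun i => y i - q (m i)) ∈ Q

/-- Fix `q (m i)` in each old interval and take the first enumerated point `q k` just to the right
of `q S.n`. A real slightly above `q (m i)`, before any other point of index at most `k`, has `m i`
as its best index, and its offset there may be any sufficiently small positive number, in particular
one close to an interior point of `Q`. -/
theorem CodingState.exists_step {ι : Type} [Finite ι] {q : ℕ → ℝ} {c d : ℝ}
    (hq : ∀ n, q n ∈ Ioo c d)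
    (hdense : ∀ u v, c ≤ u → u < v → v ≤ d → ∃ n, q n ∈ Ioo u v) {Q : Set (ι → ℝ)}
    (hQ : ∀ η > 0, ∃ w : ι → ℝ, (∀ i, w i ∈ Ioo 0 η) ∧ Q ∈ 𝓝 w) (S : CodingState ι)
    (hS : S.Valid q c d) : ∃ T : CodingState ι, T.Valid q c d ∧ S.Step q Q T := by
  classical
  cases nonempty_fintype ι
  obtain ⟨hβ, hβd, hlr⟩ := hS
  choose m hm using fun i => hdense (S.l i) (S.r i) (hlr i).1 (hlr i).2.1 (hlr i).2.2
  -- `N` exceeds `S.n` and every `m i`; the gap `γ₀` then forces the next record index `k` to be at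
  -- least `N`.
  let N := S.n + 1 + ∑ i, (m i + 1)
  have hmN : ∀ i, m i < N := fun i => by
    have := Finset.single_le_sum (f := fun i => m i + 1) (fun _ _ => Nat.zero_le _)
      (Finset.mem_univ i)
    simp only [N]
    omega
  obtain ⟨γ₀, hγ₀, hgap₀⟩ := exists_gap_right q (q S.n) N
  obtain ⟨γ, hγ, hγγ₀, hγβ⟩ : ∃ γ > 0, γ ≤ γ₀ ∧ γ ≤ S.β :=
    ⟨min γ₀ S.β, lt_min hγ₀ hβ, min_le_left _ _, min_le_right _ _⟩
  have hex := hdense (q S.n) (q S.n + γ) (hq _).1.le (by linarith) (by linarith)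
  let k := Nat.find hex
  have hk : q k ∈ Ioo (q S.n) (q S.n + γ) := Nat.find_spec hex
  have hkmin : ∀ j < k, q j ∉ Ioo (q S.n) (q S.n + γ) := fun j hj => Nat.find_min hex hj
  have hNk : N ≤ k := by
    by_contra! h
    exact hgap₀ k h ⟨hk.1, hk.2.trans_le (by linarith)⟩
  choose θ hθ hθgap using fun i => exists_gap_right q (q (m i)) (k + 1)
  obtain ⟨η, hη, hηle⟩ : ∃ η > 0, ∀ i, η ≤ θ i ∧ q (m i) + η ≤ S.r i := by
    rcases isEmpty_or_nonempty ι with h | h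
    · exact ⟨1, one_pos, fun i => h.elim i⟩
    · obtain ⟨i₀, hi₀⟩ := Finite.exists_min fun i => min (θ i) (S.r i - q (m i))
      refine ⟨_, lt_min (hθ i₀) (sub_pos.2 (hm i₀).2), fun i => ⟨?_, ?_⟩⟩
      · exact (hi₀ i).trans (min_le_left _ _)
      · have := (hi₀ i).trans (min_le_right _ _)
        linarith
  obtain ⟨w, hw, hwQ⟩ := hQ η hη
  obtain ⟨ρ₀, hρ₀, hball⟩ := Metric.mem_nhds_iff.1 hwQ
  obtain ⟨ρ, hρ, hρρ₀, hρw⟩ : ∃ ρ > 0, ρ < ρ₀ ∧ ∀ i, ρ < w i ∧ w i + ρ < η := by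
    have h1 : ∀ᶠ ρ in 𝓝[>] (0 : ℝ), ∀ i, ρ < w i ∧ w i + ρ < η := by
      rw [eventually_all]
      intro i
      filter_upwards [Ioo_mem_nhdsGT (lt_min (hw i).1 (sub_pos.2 (hw i).2))] with ρ hρ
      have h1 := hρ.2.trans_le (min_le_left _ _)
      have h2 := hρ.2.trans_le (min_le_right _ _)
      exact ⟨h1, by linarith⟩
    obtain ⟨ρ, h, h'⟩ := (h1.and (Ioo_mem_nhdsGT hρ₀)).exists
    exact ⟨ρ, h'.1, h'.2, h⟩
  -- Halving keeps `q k + β` below `q S.n + γ`, so no point of index less than `k` enters the new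
  -- interval for the first real.
  refine ⟨⟨k, (q S.n + γ - q k) / 2, fun i => q (m i) + w i - ρ, fun i => q (m i) + w i + ρ⟩,
    ⟨?_, ?_, fun i => ⟨?_, ?_, ?_⟩⟩, ?_, hk.1, ?_, ?_, fun i => ⟨?_, ?_⟩, m, ?_⟩
  · simp only
    linarith [hk.2]
  · simp only
    linarith [hk.2]
  · simp only
    linarith [(hρw i).1, (hq (m i)).1]
  · simp only
    linarith
  · simp only
    linarith [(hρw i).2, (hηle i).2, (hlr i).2.2]
  · simp only
    omega
  · simp only
    linarith [hk.2]
  · intro j hj hmem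
    simp only at hmem
    exact hkmin j hj ⟨hmem.1, by linarith [hk.2, hmem.2]⟩
  · simp only
    linarith [(hρw i).1, (hm i).1]
  · simp only
    linarith [(hρw i).2, (hηle i).2]
  · intro y hy
    simp only [mem_Ioo] at hy
    refine ⟨fun i => ⟨?_, ?_, ?_⟩, hball ?_⟩
    · simp only
      have := hmN i
      omega
    · linarith [(hρw i).1, (hy i).1]
    · intro j hj hjy
      simp only at hj
      by_contra! hlt
      exact hθgap i j (by omega) ⟨hlt, by linarith [(hρw i).2, (hy i).2, (hηle i).1]⟩
    · refine Metric.mem_ball.2 (lt_of_le_of_lt ((dist_pi_le_iff hρ.le).2 fun i => ?_) hρρ₀)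
      rw [Real.dist_eq, abs_le]
      constructor <;> linarith [(hy i).1, (hy i).2]

/-- The reals are common points of the nested intervals of iterated steps. An index strictly between
consecutive `s t` and `s (t + 1)` cannot be a record, because its point would lie in the gap kept
free by the step. -/
theorem exists_coding_reals {ι : Type} [Finite ι] {q : ℕ → ℝ} {c d : ℝ}
    (hq : ∀ n, q n ∈ Ioo c d) (hinj : Function.Injective q)
    (hdense : ∀ u v, c ≤ u → u < v → v ≤ d → ∃ n, q n ∈ Ioo u v) (Q : ℕ → Set (ι → ℝ))
    (hQ : ∀ t, ∀ η > 0, ∃ w : ι → ℝ, (∀ i, w i ∈ Ioo 0 η) ∧ Q t ∈ 𝓝 w) :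
    ∃ (x : ℝ) (y : ι → ℝ) (s : ℕ → ℕ), StrictMono s ∧
      (∀ n, BestBelow q x n n ↔ n ∈ range s) ∧
      ∀ t, ∃ m : ι → ℕ, (∀ i, BestBelow q (y i) (s (t + 1)) (m i)) ∧
        (fun i => y i - q (m i)) ∈ Q t := by
  have hcd : c < d := (hq 0).1.trans (hq 0).2
  choose! F hF using fun t (S : CodingState ι) (hS : S.Valid q c d) =>
    S.exists_step hq hdense (hQ t) hS
  -- Index `0` is a record of every real above `q 0`, so the first real starts in `(q 0, d)`.
  let S : ℕ → CodingState ι := fun t =>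
    Nat.rec ⟨0, d - q 0, fun _ => c, fun _ => d⟩ (fun t S => F t S) t
  have hvalid : ∀ t, (S t).Valid q c d := by
    intro t
    induction t with
    | zero => exact ⟨sub_pos.2 (hq 0).2, (add_sub_cancel _ _).le, fun i => ⟨le_rfl, hcd, le_rfl⟩⟩
    | succ t ih => exact (hF t _ ih).1
  have hstep : ∀ t, (S t).Step q (Q t) (S (t + 1)) := fun t => (hF t _ (hvalid t)).2
  -- Strict monotonicity of both end points puts the supremum of the left ends inside every open
  -- interval.
  have key : ∀ (a b : ℕ → ℝ), (∀ t, a t < b t) → (∀ t, a t < a (t + 1)) →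
      (∀ t, b (t + 1) < b t) → ∃ z, ∀ t, z ∈ Ioo (a t) (b t) := by
    intro a b hab ha hb
    have hmem := (strictMono_nat_of_lt_succ ha).monotone.ciSup_mem_iInter_Icc_of_antitone
      (strictAnti_nat_of_succ_lt hb).antitone fun t => (hab t).le
    rw [mem_iInter] at hmem
    exact ⟨_, fun t => ⟨(ha t).trans_le (hmem (t + 1)).1, (hmem (t + 1)).2.trans_lt (hb t)⟩⟩
  obtain ⟨x, hx⟩ := key (fun t => q (S t).n) (fun t => q (S t).n + (S t).β)
    (fun t => by have := (hvalid t).1; linarith) (fun t => (hstep t).2.1)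
    (fun t => (hstep t).2.2.1)
  choose y hy using fun i => key (fun t => (S t).l i) (fun t => (S t).r i)
    (fun t => ((hvalid t).2.2 i).2.1) (fun t => ((hstep t).2.2.2.2.1 i).1)
    (fun t => ((hstep t).2.2.2.2.1 i).2)
  have hmono : StrictMono fun t => (S t).n := strictMono_nat_of_lt_succ fun t => (hstep t).1
  refine ⟨x, y, fun t => (S t).n, hmono, fun n => ⟨fun h => ?_, ?_⟩, fun t => ?_⟩
  · have hex : ∃ t, n ≤ (S t).n := ⟨n, hmono.id_le n⟩
    rcases Nat.eq_zero_or_pos (Nat.find hex) with h0 | h0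
    · have := Nat.find_spec hex
      rw [h0] at this
      exact ⟨0, (Nat.le_zero.1 this).symm⟩
    · obtain ⟨t, ht⟩ := Nat.exists_eq_succ_of_ne_zero h0.ne'
      have hle := Nat.find_spec hex
      have hlt := Nat.find_min hex (m := t) (by omega)
      rw [ht] at hle
      rcases hle.eq_or_lt with heq | hlt'
      · exact ⟨t.succ, heq.symm⟩
      · push Not at hlt
        exfalso
        refine (hstep t).2.2.2.1 n hlt' ⟨lt_of_le_of_ne (h.2.2 _ hlt.le (hx t).1) ?_,
          h.2.1.trans (hx (t + 1)).2⟩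
        exact fun h' => hlt.ne (hinj h')
  · rintro ⟨t, rfl⟩
    refine ⟨le_rfl, (hx t).1, fun i hi hix => ?_⟩
    rcases hi.eq_or_lt with rfl | hi
    · exact le_rfl
    rcases t with - | t
    · exact absurd hi (Nat.not_lt_zero _)
    · by_contra! hlt
      exact (hstep t).2.2.2.1 i hi ⟨(hstep t).2.1.trans hlt, hix.trans (hx (t + 1)).2⟩
  · obtain ⟨m, hm⟩ := (hstep t).2.2.2.2.2
    exact ⟨m, hm y fun i => hy i (t + 1)⟩

end Coding

/-! ### Reading enumerated points off the offsets by means of increments of `f`. -/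

section Decoding

open Filter Topology

/-- `u` is enumerated by `q` no later than `v`. -/
def IdxLe (q : ℕ → ℝ) (u v : ℝ) : Prop := ∃ i j, i ≤ j ∧ q i = u ∧ q j = v

/-- `u` is enumerated by `q` before `v`. -/
def IdxLt (q : ℕ → ℝ) (u v : ℝ) : Prop := ∃ i j, i < j ∧ q i = u ∧ q j = v

/-- `w` is the distance of `y` to its best approximation from below among the points enumerated
no later than `u`. -/
def Offset (q : ℕ → ℝ) (y u w : ℝ) : Prop :=
  ∃ m, IdxLe q m u ∧ m < y ∧ (∀ e, IdxLe q e u → e < y → e ≤ m) ∧ y = m + w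

/-- `u` is the best approximation from below of `x` among the points enumerated no later. -/
def Record (q : ℕ → ℝ) (x u : ℝ) : Prop :=
  IdxLe q u u ∧ u < x ∧ ∀ e, IdxLe q e u → e < x → e ≤ u

/-- The record `u` of `x` starts a block: the offset of `b₀` at `u` is smaller than that of `b₁`. -/
def BlockStart (q : ℕ → ℝ) (x b₀ b₁ u : ℝ) : Prop :=
  Record q x u ∧ ∃ v₀ v₁, Offset q b₀ u v₀ ∧ Offset q b₁ u v₁ ∧ v₀ < v₁

/-- The increment of `f` from `z` to `z + ε` lies strictly between `α - β` and `α - β + γ`. -/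
def Fits (f : ℝ → ℝ) (I : Set ℝ) (z ε α β γ : ℝ) : Prop :=
  z ∈ I ∧ z + ε ∈ I ∧ f z + α < f (z + ε) + β ∧ f (z + ε) + β < f z + α + γ

/-- The point `e` satisfies the constraint given by the offsets of `g 0, …, g 3` at `u`. -/
def FitsAt (q : ℕ → ℝ) (f : ℝ → ℝ) (I : Set ℝ) (g : Fin 4 → ℝ) (u e : ℝ) : Prop :=
  ∃ ε α β γ, Offset q (g 0) u ε ∧ Offset q (g 1) u α ∧ Offset q (g 2) u β ∧ Offset q (g 3) u γ ∧
    Fits f I e ε α β γ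

/-- The point `e` satisfies the constraints at all records of the block that starts at `s`. -/
def FitsBlock (q : ℕ → ℝ) (f : ℝ → ℝ) (I : Set ℝ) (x b₀ b₁ : ℝ) (g : Fin 4 → ℝ) (s e : ℝ) : Prop :=
  ∀ u, Record q x u → IdxLe q s u →
    (∀ u', Record q x u' → IdxLt q s u' → IdxLe q u' u → ¬ BlockStart q x b₀ b₁ u') →
    FitsAt q f I g u e

/-- The block that starts at `s` encodes `e`: it is the first enumerated point satisfying all
constraints of the block. -/
def Encodes (q : ℕ → ℝ) (f : ℝ → ℝ) (I : Set ℝ) (x b₀ b₁ : ℝ) (g : Fin 4 → ℝ) (s e : ℝ) : Prop :=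
  IdxLe q e e ∧ FitsBlock q f I x b₀ b₁ g s e ∧
    ∀ e', IdxLt q e' e → ¬ FitsBlock q f I x b₀ b₁ g s e'

variable {q : ℕ → ℝ}

theorem idxLe_iff (hinj : Function.Injective q) {i j : ℕ} : IdxLe q (q i) (q j) ↔ i ≤ j := by
  refine ⟨?_, fun h => ⟨i, j, h, rfl, rfl⟩⟩
  rintro ⟨i', j', h, hi, hj⟩
  rwa [← hinj hi, ← hinj hj]

theorem idxLt_iff (hinj : Function.Injective q) {i j : ℕ} : IdxLt q (q i) (q j) ↔ i < j := by
  refine ⟨?_, fun h => ⟨i, j, h, rfl, rfl⟩⟩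
  rintro ⟨i', j', h, hi, hj⟩
  rwa [← hinj hi, ← hinj hj]

theorem idxLe_apply_iff (hinj : Function.Injective q) {u : ℝ} {j : ℕ} :
    IdxLe q u (q j) ↔ ∃ i ≤ j, q i = u := by
  constructor
  · rintro ⟨i, j', h, hi, hj⟩
    exact ⟨i, hinj hj ▸ h, hi⟩
  · rintro ⟨i, h, rfl⟩
    exact ⟨i, j, h, rfl, rfl⟩

theorem offset_apply_iff (hinj : Function.Injective q) {y w : ℝ} {n m : ℕ}
    (h : BestBelow q y n m) : Offset q y (q n) w ↔ w = y - q m := by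
  constructor
  · rintro ⟨u, hu, huy, hmax, rfl⟩
    obtain ⟨i, hi, rfl⟩ := (idxLe_apply_iff hinj).1 hu
    have h1 := hmax (q m) ((idxLe_iff hinj).2 h.1) h.2.1
    have h2 := h.2.2 i hi huy
    linarith
  · rintro rfl
    refine ⟨q m, (idxLe_iff hinj).2 h.1, h.2.1, fun e he hey => ?_, by ring⟩
    obtain ⟨i, hi, rfl⟩ := (idxLe_apply_iff hinj).1 he
    exact h.2.2 i hi hey

theorem record_apply_iff (hinj : Function.Injective q) {x : ℝ} {n : ℕ} :
    Record q x (q n) ↔ BestBelow q x n n := by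
  constructor
  · rintro ⟨-, h, hmax⟩
    exact ⟨le_rfl, h, fun i hi => hmax _ ((idxLe_iff hinj).2 hi)⟩
  · rintro ⟨-, h, hmax⟩
    refine ⟨(idxLe_iff hinj).2 le_rfl, h, fun e he hex => ?_⟩
    obtain ⟨i, hi, rfl⟩ := (idxLe_apply_iff hinj).1 he
    exact hmax i hi hex

theorem Record.exists_eq {x u : ℝ} (h : Record q x u) : ∃ n, q n = u := by
  obtain ⟨i, _, _, hi, _⟩ := h.1
  exact ⟨i, hi⟩

/-- Arbitrarily small constraints fulfilled by one point and violated by another one. -/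
theorem exists_fits {f : ℝ → ℝ} {c d : ℝ} (hf : ContinuousOn f (Ioo c d))
    (hsep : ∀ x ∈ Ioo c d, ∀ y ∈ Ioo c d, x < y → ∀ δ > 0,
      ∃ ε ∈ Ioo 0 δ, f (x + ε) - f x ≠ f (y + ε) - f y)
    {z z' : ℝ} (hz : z ∈ Ioo c d) (hz' : z' ∈ Ioo c d) {η : ℝ} (hη : 0 < η) :
    ∃ w : Fin 4 → ℝ, (∀ i, w i ∈ Ioo 0 η) ∧
      ∀ᶠ w' in 𝓝 w, Fits f (Ioo c d) z (w' 0) (w' 1) (w' 2) (w' 3) ∧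
        (z' ≠ z → ¬ Fits f (Ioo c d) z' (w' 0) (w' 1) (w' 2) (w' 3)) := by
  have hcz : ∀ x ∈ Ioo c d, ContinuousAt f x := fun x hx => hf.continuousAt (Ioo_mem_nhds hx.1 hx.2)
  have hsmall : ∃ δ > 0, ∀ ε ∈ Ioo 0 δ, z + ε < d ∧ z' + ε < d ∧ |f (z + ε) - f z| < η / 4 := by
    obtain ⟨ρ, hρ, h⟩ := Metric.continuousAt_iff.1 (hcz z hz) (η / 4) (by linarith)
    refine ⟨min ρ (min (d - z) (d - z')), lt_min hρ (lt_min (sub_pos.2 hz.2) (sub_pos.2 hz'.2)),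
      fun ε hε => ?_⟩
    obtain ⟨h0, h1⟩ := hε
    rw [lt_min_iff, lt_min_iff] at h1
    refine ⟨by linarith [h1.2.1], by linarith [h1.2.2], ?_⟩
    rw [← Real.dist_eq]
    apply h
    rw [Real.dist_eq, add_sub_cancel_left, abs_of_pos h0]
    exact h1.1
  obtain ⟨δ, hδ, hsmall⟩ := hsmall
  obtain ⟨ε, ⟨hε, hεδη⟩, hne⟩ : ∃ ε ∈ Ioo 0 (min δ η),
      z' ≠ z → f (z + ε) - f z ≠ f (z' + ε) - f z' := by
    have hpos : 0 < min δ η := lt_min hδ hη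
    rcases lt_trichotomy z z' with h | h | h
    · obtain ⟨ε, h1, h2⟩ := hsep z hz z' hz' h _ hpos
      exact ⟨ε, h1, fun _ => h2⟩
    · exact ⟨min δ η / 2, ⟨by linarith, by linarith⟩, fun h' => absurd h.symm h'⟩
    · obtain ⟨ε, h1, h2⟩ := hsep z' hz' z hz h _ hpos
      exact ⟨ε, h1, fun _ => h2.symm⟩
  obtain ⟨hεδ, hεη⟩ := lt_min_iff.1 hεδη
  obtain ⟨hzd, hzd', hfz⟩ := hsmall ε ⟨hε, hεδ⟩
  obtain ⟨γ, hγ, hγη, hγv⟩ : ∃ γ > 0, γ ≤ η / 4 ∧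
      (z' ≠ z → γ < |f (z' + ε) - f z' - (f (z + ε) - f z)|) := by
    by_cases h : z' = z
    · exact ⟨η / 4, by linarith, le_rfl, fun h' => absurd h h'⟩
    · have h0 : 0 < |f (z' + ε) - f z' - (f (z + ε) - f z)| :=
        abs_pos.2 (sub_ne_zero.2 (hne h).symm)
      refine ⟨min (η / 4) (|f (z' + ε) - f z' - (f (z + ε) - f z)| / 2),
        lt_min (by linarith) (by linarith), min_le_left _ _, fun _ => ?_⟩
      exact (min_le_right _ _).trans_lt (by linarith)
  rw [abs_lt] at hfz
  -- Offsets are positive while the increment of `f` may be negative, so its lower bound is coded as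
  -- a difference `α - β`. The window is centred at the increment at `z` and has width `γ`, less
  -- than the distance to the increment at `z'`; the bounds by `η / 4` keep `α` in `(0, η)`.
  let w : Fin 4 → ℝ := ![ε, η / 2 + (f (z + ε) - f z) - γ / 2, η / 2, γ]
  have hw : ∀ i, Tendsto (fun w' : Fin 4 → ℝ => w' i) (𝓝 w) (𝓝 (w i)) := fun i =>
    (continuous_apply i).tendsto w
  have hmem : ∀ {x}, x ∈ Ioo c d → x + ε < d → x + ε ∈ Ioo c d := fun hx h =>
    ⟨by linarith [hx.1], h⟩
  have hshift : ∀ x, Tendsto (fun w' : Fin 4 → ℝ => x + w' 0) (𝓝 w) (𝓝 (x + ε)) :=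
    fun x => tendsto_const_nhds.add (hw 0)
  have hfsh : ∀ {x}, x ∈ Ioo c d → x + ε < d →
      Tendsto (fun w' : Fin 4 → ℝ => f (x + w' 0) + w' 2) (𝓝 w) (𝓝 (f (x + ε) + η / 2)) :=
    fun hx h => ((hcz _ (hmem hx h)).tendsto.comp (hshift _)).add (hw 2)
  have hlow : ∀ x, Tendsto (fun w' : Fin 4 → ℝ => f x + w' 1) (𝓝 w)
      (𝓝 (f x + (η / 2 + (f (z + ε) - f z) - γ / 2))) :=
    fun x => tendsto_const_nhds.add (hw 1)
  have hupp : ∀ x, Tendsto (fun w' : Fin 4 → ℝ => f x + w' 1 + w' 3) (𝓝 w)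
      (𝓝 (f x + (η / 2 + (f (z + ε) - f z) - γ / 2) + γ)) :=
    fun x => (hlow x).add (hw 3)
  refine ⟨w, fun i => ?_, ?_⟩
  · fin_cases i
    · exact ⟨hε, hεη⟩
    · exact ⟨show 0 < η / 2 + (f (z + ε) - f z) - γ / 2 by linarith,
        show η / 2 + (f (z + ε) - f z) - γ / 2 < η by linarith⟩
    · exact ⟨show 0 < η / 2 by linarith, show η / 2 < η by linarith⟩
    · exact ⟨hγ, show γ < η by linarith⟩
  · have hz0 := hmem hz hzd
    have hfit : ∀ᶠ w' in 𝓝 w, Fits f (Ioo c d) z (w' 0) (w' 1) (w' 2) (w' 3) :=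
      (Eventually.of_forall fun _ => hz).and <|
        ((hshift z).eventually_mem (Ioo_mem_nhds hz0.1 hz0.2)).and
        (((hlow z).eventually_lt (hfsh hz hzd) (by linarith)).and
          ((hfsh hz hzd).eventually_lt (hupp z) (by linarith)))
    have hnot : ∀ᶠ w' in 𝓝 w,
        z' ≠ z → ¬ Fits f (Ioo c d) z' (w' 0) (w' 1) (w' 2) (w' 3) := by
      by_cases h : z' = z
      · exact Eventually.of_forall fun _ h' => absurd h h'
      rcases lt_abs.1 (hγv h) with h' | h'
      · filter_upwards [(hupp z').eventually_lt (hfsh hz' hzd') (by linarith)] with w' h1 _ h2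
        exact lt_asymm h1 h2.2.2.2
      · filter_upwards [(hfsh hz' hzd').eventually_lt (hlow z') (by linarith)] with w' h1 _ h2
        exact lt_asymm h1 h2.2.2.1
    exact hfit.and hnot

/-- Every sequence of finite tuples of enumerated points is encoded by finitely many reals. -/
theorem exists_encoding {f : ℝ → ℝ} {c d : ℝ} (hf : ContinuousOn f (Ioo c d))
    (hsep : ∀ x ∈ Ioo c d, ∀ y ∈ Ioo c d, x < y → ∀ δ > 0,
      ∃ ε ∈ Ioo 0 δ, f (x + ε) - f x ≠ f (y + ε) - f y)
    (hq : ∀ n, q n ∈ Ioo c d) (hinj : Function.Injective q)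
    (hdense : ∀ u v, c ≤ u → u < v → v ≤ d → ∃ n, q n ∈ Ioo u v) {k : ℕ}
    (p : ℕ → Fin k → ℕ) :
    ∃ (x b₀ b₁ : ℝ) (g : Fin k → Fin 4 → ℝ) (n₀ : ℕ) (s : ℕ → ℕ), StrictMono s ∧
      (∀ n, n₀ < s n) ∧
      (∀ m, n₀ < m → (BlockStart q x b₀ b₁ (q m) ↔ ∃ n, s n = m)) ∧
      ∀ n j e, Encodes q f (Ioo c d) x b₀ b₁ (g j) (q (s n)) e ↔ e = q (p n j) := by
  classical
  -- Block `n` consists of the stages from `N n` to `N (n + 1) - 1`; its length exceeds every `p n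
  -- j`, leaving a stage to exclude each `q i` with `i < p n j`.
  let N : ℕ → ℕ := fun n => ∑ m ∈ Finset.range n, (1 + ∑ j, p m j)
  have hN : ∀ n j, N n + p n j < N (n + 1) := fun n j => by
    have := Finset.single_le_sum (f := p n) (fun _ _ => Nat.zero_le _) (Finset.mem_univ j)
    simp only [N, Finset.sum_range_succ]
    omega
  have hNmono : StrictMono N := strictMono_nat_of_lt_succ fun n => by
    simp only [N, Finset.sum_range_succ]
    omega
  have hblock : ∀ t, ∃ n, N n ≤ t ∧ t < N (n + 1) := fun t => by
    induction t with
    | zero =>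
      refine ⟨0, by simp [N], ?_⟩
      exact (Nat.zero_le _).trans_lt (hNmono Nat.zero_lt_one)
    | succ t ih =>
      obtain ⟨n, h1, h2⟩ := ih
      rcases (Nat.succ_le_of_lt h2).eq_or_lt with h | h
      · exact ⟨n + 1, h.ge, h.le.trans_lt (hNmono (Nat.lt_succ_self (n + 1)))⟩
      · exact ⟨n, by omega, h⟩
  have huniq : ∀ {t n n'}, N n ≤ t → t < N (n + 1) → N n' ≤ t → t < N (n' + 1) → n = n' := by
    intro t n n' h1 h2 h3 h4
    have h5 := hNmono.lt_iff_lt.1 (h1.trans_lt h4)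
    have h6 := hNmono.lt_iff_lt.1 (h3.trans_lt h2)
    omega
  choose B hB using hblock
  -- The Boolean coordinates mark block starts. Stage `N n + i` admits the targets `q (p n j)` and
  -- excludes `q i` wherever it is not the target.
  let Q : ℕ → Set (Bool ⊕ (Fin k × Fin 4) → ℝ) := fun t =>
    {w | (N (B t) = t → w (.inl false) < w (.inl true)) ∧
      (N (B t) ≠ t → w (.inl true) < w (.inl false)) ∧
      ∀ j, Fits f (Ioo c d) (q (p (B t) j))
          (w (.inr (j, 0))) (w (.inr (j, 1))) (w (.inr (j, 2))) (w (.inr (j, 3))) ∧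
        (q (t - N (B t)) ≠ q (p (B t) j) → ¬ Fits f (Ioo c d) (q (t - N (B t)))
          (w (.inr (j, 0))) (w (.inr (j, 1))) (w (.inr (j, 2))) (w (.inr (j, 3))))}
  have hQ : ∀ t, ∀ η > 0, ∃ w, (∀ i, w i ∈ Ioo 0 η) ∧ Q t ∈ 𝓝 w := by
    intro t η hη
    choose w hw hfit using fun j => exists_fits hf hsep (hq (p (B t) j)) (hq (t - N (B t))) hη
    let b : Bool → ℝ := fun i =>
      if (N (B t) = t ↔ i = true) then 2 * η / 3 else η / 3
    let W : Bool ⊕ (Fin k × Fin 4) → ℝ := Sum.elim b fun i => w i.1 i.2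
    have hW : ∀ i, Tendsto (fun w' : Bool ⊕ (Fin k × Fin 4) → ℝ => w' i) (𝓝 W) (𝓝 (W i)) :=
      fun i => (continuous_apply i).tendsto W
    refine ⟨W, ?_, ?_⟩
    · rintro (i | ⟨j, i⟩)
      · change b i ∈ Ioo 0 η
        simp only [b]
        split_ifs <;> constructor <;> linarith
      · exact hw j i
    · have h1 : ∀ᶠ w' in 𝓝 W, N (B t) = t → w' (.inl false) < w' (.inl true) := by
        by_cases h : N (B t) = t
        · filter_upwards [(hW (.inl false)).eventually_lt (hW (.inl true))
            (by simp only [W, b, Sum.elim_inl, h]; norm_num; linarith)] with w' h' _ using h'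
        · exact Eventually.of_forall fun _ h' => absurd h' h
      have h2 : ∀ᶠ w' in 𝓝 W, N (B t) ≠ t → w' (.inl true) < w' (.inl false) := by
        by_cases h : N (B t) = t
        · exact Eventually.of_forall fun _ h' => absurd h h'
        · filter_upwards [(hW (.inl true)).eventually_lt (hW (.inl false))
            (by simp only [W, b, Sum.elim_inl, h]; norm_num; linarith)] with w' h' _ using h'
      have h3 := eventually_all.2 fun j =>
        (tendsto_pi_nhds.2 fun i => hW (.inr (j, i))).eventually (hfit j)
      exact h1.and (h2.and h3)
  obtain ⟨x, y, s, hs, hrec, hdata⟩ := exists_coding_reals hq hinj hdense Q hQ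
  choose m hm hmQ using hdata
  -- Stage `t` is read at the record `s (t + 1)`. Offsets at `s 0` are uncontrolled, so block starts
  -- are characterised only beyond `n₀ = s 0`.
  have hoff : ∀ t i w, Offset q (y i) (q (s (t + 1))) w ↔ w = y i - q (m t i) :=
    fun t i w => offset_apply_iff hinj (hm t i)
  have hrecord : ∀ u, Record q x u ↔ ∃ t, q (s t) = u := fun u => by
    constructor
    · intro h
      obtain ⟨n, rfl⟩ := h.exists_eq
      obtain ⟨t, rfl⟩ := (hrec n).1 ((record_apply_iff hinj).1 h)
      exact ⟨t, rfl⟩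
    · rintro ⟨t, rfl⟩
      exact (record_apply_iff hinj).2 ((hrec _).2 ⟨t, rfl⟩)
  have hstart : ∀ t, BlockStart q x (y (.inl false)) (y (.inl true)) (q (s (t + 1))) ↔
      N (B t) = t := fun t => by
    simp only [BlockStart, hoff]
    constructor
    · rintro ⟨-, v₀, v₁, rfl, rfl, h⟩
      by_contra hne
      exact lt_asymm h ((hmQ t).2.1 hne)
    · intro h
      exact ⟨(hrecord _).2 ⟨_, rfl⟩, _, _, rfl, rfl, (hmQ t).1 h⟩
  have hBN : ∀ n, B (N n) = n := fun n =>
    huniq (hB _).1 (hB _).2 le_rfl (hNmono (Nat.lt_succ_self n))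
  have hfitsAt : ∀ t j e, FitsAt q f (Ioo c d) (fun i => y (.inr (j, i))) (q (s (t + 1))) e ↔
      Fits f (Ioo c d) e (y (.inr (j, 0)) - q (m t (.inr (j, 0))))
        (y (.inr (j, 1)) - q (m t (.inr (j, 1)))) (y (.inr (j, 2)) - q (m t (.inr (j, 2))))
        (y (.inr (j, 3)) - q (m t (.inr (j, 3)))) := fun t j e => by
    simp only [FitsAt, hoff]
    constructor
    · rintro ⟨_, _, _, _, rfl, rfl, rfl, rfl, h⟩
      exact h
    · intro h
      exact ⟨_, _, _, _, rfl, rfl, rfl, rfl, h⟩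
  have hfitsBlock : ∀ n j e, FitsBlock q f (Ioo c d) x (y (.inl false)) (y (.inl true))
      (fun i => y (.inr (j, i))) (q (s (N n + 1))) e ↔ ∀ t, N n ≤ t → t < N (n + 1) →
      FitsAt q f (Ioo c d) (fun i => y (.inr (j, i))) (q (s (t + 1))) e := fun n j e => by
    constructor
    · intro h t h1 h2
      refine h _ ((hrecord _).2 ⟨_, rfl⟩)
        ((idxLe_iff hinj).2 (hs.monotone (Nat.succ_le_succ h1))) ?_
      intro u' hu' hlt hle
      obtain ⟨τ, rfl⟩ := (hrecord _).1 hu'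
      have hlt := hs.lt_iff_lt.1 ((idxLt_iff hinj).1 hlt)
      have hle := hs.le_iff_le.1 ((idxLe_iff hinj).1 hle)
      obtain ⟨τ, rfl⟩ := Nat.exists_eq_succ_of_ne_zero (n := τ) (by omega)
      have hBτ : B τ = n := huniq (hB τ).1 (hB τ).2 (by omega) (by omega)
      rw [Nat.succ_eq_add_one, hstart, hBτ]
      omega
    · intro h u hu hle hno
      obtain ⟨τ, rfl⟩ := (hrecord _).1 hu
      have hle := hs.le_iff_le.1 ((idxLe_iff hinj).1 hle)
      obtain ⟨τ, rfl⟩ := Nat.exists_eq_succ_of_ne_zero (n := τ) (by omega)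
      refine h τ (by omega) ?_
      -- A record past the block would have the start of block `n + 1` between it and the start of
      -- block `n`.
      by_contra! hge
      have hlt := hNmono (Nat.lt_succ_self n)
      refine hno (q (s (N (n + 1) + 1))) ((hrecord _).2 ⟨_, rfl⟩)
        ((idxLt_iff hinj).2 (hs (Nat.succ_lt_succ hlt)))
        ((idxLe_iff hinj).2 (hs.monotone (Nat.succ_le_succ hge))) ?_
      rw [hstart, hBN]
  refine ⟨x, y (.inl false), y (.inl true), fun j i => y (.inr (j, i)), s 0,
    fun n => s (N n + 1), hs.comp (fun a b h => Nat.succ_lt_succ (hNmono h)),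
    fun n => hs (Nat.succ_pos _), fun r hr => ⟨fun h => ?_, ?_⟩, fun n j e => ?_⟩
  · obtain ⟨τ, hτ⟩ := (hrecord _).1 h.1
    obtain rfl := hinj hτ
    obtain ⟨τ, rfl⟩ := Nat.exists_eq_succ_of_ne_zero (n := τ) (by rintro rfl; omega)
    exact ⟨B τ, congrArg (fun r => s (r + 1)) ((hstart τ).1 h)⟩
  · rintro ⟨n, rfl⟩
    rw [hstart, hBN]
  · have htarget : FitsBlock q f (Ioo c d) x (y (.inl false)) (y (.inl true))
        (fun i => y (.inr (j, i))) (q (s (N n + 1))) (q (p n j)) := by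
      rw [hfitsBlock]
      intro t h1 h2
      have hBt : B t = n := huniq (hB t).1 (hB t).2 h1 h2
      have := ((hmQ t).2.2 j).1
      rw [hBt] at this
      exact (hfitsAt t j _).2 this
    have hother : ∀ i < p n j, ¬ FitsBlock q f (Ioo c d) x (y (.inl false)) (y (.inl true))
        (fun i => y (.inr (j, i))) (q (s (N n + 1))) (q i) := by
      intro i hi h
      rw [hfitsBlock] at h
      have hlt := hN n j
      have hBt : B (N n + i) = n :=
        huniq (hB _).1 (hB _).2 (Nat.le_add_right _ _) (by omega)
      have h' := ((hmQ (N n + i)).2.2 j).2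
      rw [hBt, Nat.add_sub_cancel_left] at h'
      exact h' (fun h'' => hi.ne (hinj h''))
        ((hfitsAt _ j _).1 (h (N n + i) (Nat.le_add_right _ _) (by omega)))
    constructor
    · rintro ⟨⟨i, _, _, rfl, _⟩, hfit, hmin⟩
      rcases lt_trichotomy i (p n j) with h | h | h
      · exact absurd hfit (hother i h)
      · rw [h]
      · exact absurd htarget (hmin _ ((idxLt_iff hinj).2 h))
    · rintro rfl
      refine ⟨(idxLe_iff hinj).2 le_rfl, htarget, ?_⟩
      rintro e' ⟨i, i', hlt, rfl, hi'⟩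
      exact hother i (hinj hi' ▸ hlt)

end Decoding

/-! ### Definability of the enumeration and of the decoding relations. -/

section Definability

variable {L : FirstOrder.Language.{u, v}} [L.Structure ℝ]

theorem DPred.eq (φ : addLt.LHom L) [φ.IsExpansionOn ℝ] {α : Type} {t t' : (α → ℝ) → ℝ}
    (ht : DTerm L t) (ht' : DTerm L t') : DPred L fun w => t w = t' w := by
  simpa only [le_antisymm_iff] using (DPred.le φ ht ht').and (DPred.le φ ht' ht)

theorem DPred.mem_Ioo (φ : addLt.LHom L) [φ.IsExpansionOn ℝ] {α : Type} {t : (α → ℝ) → ℝ}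
    (ht : DTerm L t) (a b : ℝ) : DPred L fun w => t w ∈ Ioo a b :=
  (DPred.lt φ (.const a) ht).and (DPred.lt φ ht (.const b))

/-- A dense `ω`-orderable set yields in every interval a subinterval and an injective dense
sequence in it whose enumeration order is definable. -/
theorem exists_dense_enumeration (φ : addLt.LHom L) [φ.IsExpansionOn ℝ] {D : Set ℝ}
    (hD : OmegaOrderable L D) (hdense : DenseInSomeInterval D) {a b : ℝ} (hab : a < b) :
    ∃ (c d : ℝ) (q : ℕ → ℝ), c < d ∧ Ioo c d ⊆ Ioo a b ∧ (∀ n, q n ∈ Ioo c d) ∧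
      Function.Injective q ∧
      (∀ u v, c ≤ u → u < v → v ≤ d → ∃ n, q n ∈ Ioo u v) ∧
      DPred L fun w : Fin 2 → ℝ => IdxLt q (w 0) (w 1) := by
  obtain ⟨a₀, b₀, hab₀, hcl⟩ := hdense
  obtain ⟨-, hfin | ⟨R, hR, ⟨e⟩⟩⟩ := hD
  · rw [hfin.isClosed.closure_eq] at hcl
    exact absurd (hfin.subset hcl) (Ioo_infinite hab₀)
  obtain ⟨r, hr, hra, hra₀⟩ : ∃ r > 0, r ≤ (b - a) / 2 ∧ r ≤ (b₀ - a₀) / 2 :=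
    ⟨min ((b - a) / 2) ((b₀ - a₀) / 2), lt_min (by linarith) (by linarith), min_le_left _ _,
      min_le_right _ _⟩
  -- A translation, definable from addition and a parameter, matches the midpoints of the two
  -- intervals; the radius `r` fits into both.
  obtain ⟨τ, hτ⟩ : ∃ τ, τ = (a + b) / 2 - (a₀ + b₀) / 2 := ⟨_, rfl⟩
  obtain ⟨c, hc⟩ : ∃ c, c = (a + b) / 2 - r := ⟨_, rfl⟩
  obtain ⟨d, hd⟩ : ∃ d, d = (a + b) / 2 + r := ⟨_, rfl⟩
  have hcd : c < d := by linarith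
  let E : ℕ → ℝ := fun n => e.symm n + τ
  have hE : Function.Injective E := fun m n h =>
    e.symm.injective (Subtype.ext (add_right_cancel h))
  have hEdense : ∀ u v, c ≤ u → u < v → v ≤ d → ∃ n, E n ∈ Ioo u v := by
    intro u v hu huv hv
    have hmem : (u + v) / 2 - τ ∈ closure D := hcl ⟨by linarith, by linarith⟩
    obtain ⟨z, hz, hzD⟩ := mem_closure_iff.1 hmem (Ioo (u - τ) (v - τ)) isOpen_Ioo
      ⟨by linarith, by linarith⟩
    refine ⟨e ⟨z, hzD⟩, ?_⟩
    simp only [E, RelIso.symm_apply_apply]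
    exact ⟨by linarith [hz.1], by linarith [hz.2]⟩
  have hinf : {n | E n ∈ Ioo c d}.Infinite := by
    intro hfin
    have hfin' := (hfin.image E).isClosed.closure_eq
    refine Ioo_infinite hcd ((hfin.image E).subset ?_)
    rw [← hfin']
    intro z hz
    refine Metric.mem_closure_iff.2 fun ρ hρ => ?_
    obtain ⟨n, hn⟩ := hEdense z (min d (z + ρ)) hz.1.le (lt_min hz.2 (by linarith))
      (min_le_left _ _)
    have h1 := hn.2.trans_le (min_le_left _ _)
    have h2 := hn.2.trans_le (min_le_right _ _)
    refine ⟨E n, ⟨n, ⟨hz.1.trans hn.1, h1⟩, rfl⟩, ?_⟩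
    rw [dist_comm, Real.dist_eq, abs_of_pos (sub_pos.2 hn.1)]
    linarith
  -- Listing in increasing order the infinitely many indices that land in `(c, d)` preserves the
  -- definable order.
  let σ : ℕ → ℕ := Nat.nth fun n => E n ∈ Ioo c d
  have hσ : StrictMono σ := Nat.nth_strictMono hinf
  have hσmem : ∀ n, E (σ n) ∈ Ioo c d := fun n => Nat.nth_mem_of_infinite hinf n
  have hσrange : ∀ n, E n ∈ Ioo c d → ∃ k, σ k = n := fun n hn => by
    have := Nat.range_nth_of_infinite hinf
    exact (Set.ext_iff.1 this n).2 hn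
  refine ⟨c, d, fun n => E (σ n), hcd, Ioo_subset_Ioo (by linarith) (by linarith), hσmem,
    hE.comp hσ.injective, fun u v hu huv hv => ?_, ?_⟩
  · obtain ⟨n, hn⟩ := hEdense u v hu huv hv
    obtain ⟨k, rfl⟩ := hσrange n ⟨by linarith [hn.1], by linarith [hn.2]⟩
    exact ⟨k, hn⟩
  · have hiff : ∀ w : Fin 2 → ℝ, IdxLt (fun n => E (σ n)) (w 0) (w 1) ↔
        w 0 ∈ Ioo c d ∧ w 1 ∈ Ioo c d ∧ ∃ u, ∃ v, u + τ = w 0 ∧ v + τ = w 1 ∧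
          (u ∈ D ∧ v ∈ D ∧ R u v) := by
      intro w
      constructor
      · rintro ⟨i, j, hij, hi, hj⟩
        rw [← hi, ← hj]
        refine ⟨hσmem i, hσmem j, _, _, rfl, rfl, (e.symm _).2, (e.symm _).2, ?_⟩
        exact e.symm.map_rel_iff.2 (hσ hij)
      · rintro ⟨h0, h1, u, v, hu, hv, huD, hvD, huv⟩
        have hEu : E (e ⟨u, huD⟩) = w 0 := by simp only [E, RelIso.symm_apply_apply, hu]
        have hEv : E (e ⟨v, hvD⟩) = w 1 := by simp only [E, RelIso.symm_apply_apply, hv]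
        obtain ⟨i, hi⟩ := hσrange (e ⟨u, huD⟩) (hEu ▸ h0)
        obtain ⟨j, hj⟩ := hσrange (e ⟨v, hvD⟩) (hEv ▸ h1)
        refine ⟨i, j, hσ.lt_iff_lt.1 ?_, (congrArg E hi).trans hEu, (congrArg E hj).trans hEv⟩
        rw [hi, hj]
        exact e.map_rel_iff.2 huv
    simp only [hiff]
    refine (DPred.mem_Ioo φ (.var 0) _ _).and ((DPred.mem_Ioo φ (.var 1) _ _).and ?_)
    refine .ex (.ex ?_)
    refine (DPred.eq φ (.add φ (.var _) (.const _)) (.var _)).and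
      ((DPred.eq φ (.add φ (.var _) (.const _)) (.var _)).and ?_)
    exact DPred.rel₂ (R := fun u v => u ∈ D ∧ v ∈ D ∧ R u v) hR (.var _) (.var _)

variable {q : ℕ → ℝ} {α : Type}

theorem DPred.idxLe (φ : addLt.LHom L) [φ.IsExpansionOn ℝ]
    (hlt : DPred L fun w : Fin 2 → ℝ => IdxLt q (w 0) (w 1)) {t t' : (α → ℝ) → ℝ}
    (ht : DTerm L t) (ht' : DTerm L t') : DPred L fun w => IdxLe q (t w) (t' w) := by
  -- Every enumerated point has a successor, so `∃ z, IdxLt q u z` expresses that `u` is enumerated.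
  have hiff : ∀ u v, IdxLe q u v ↔ IdxLt q u v ∨ (u = v ∧ ∃ z, IdxLt q u z) := by
    intro u v
    constructor
    · rintro ⟨i, j, hij, rfl, rfl⟩
      rcases hij.lt_or_eq with h | rfl
      · exact Or.inl ⟨i, j, h, rfl, rfl⟩
      · exact Or.inr ⟨rfl, q (i + 1), i, i + 1, Nat.lt_succ_self i, rfl, rfl⟩
    · rintro (⟨i, j, hij, rfl, rfl⟩ | ⟨rfl, z, i, j, -, rfl, -⟩)
      · exact ⟨i, j, hij.le, rfl, rfl⟩
      · exact ⟨i, i, le_rfl, rfl, rfl⟩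
  refine DPred.rel₂ (R := IdxLe q) ?_ ht ht'
  simp only [hiff]
  exact hlt.or ((DPred.eq φ (.var _) (.var _)).and (.ex (.rel₂ hlt (.var _) (.var _))))

theorem DPred.offset (φ : addLt.LHom L) [φ.IsExpansionOn ℝ]
    (hlt : DPred L fun w : Fin 2 → ℝ => IdxLt q (w 0) (w 1)) (y : ℝ) {t t' : (α → ℝ) → ℝ}
    (ht : DTerm L t) (ht' : DTerm L t') : DPred L fun w => Offset q y (t w) (t' w) := by
  refine DPred.rel₂ (R := Offset q y) ?_ ht ht'
  unfold Offset
  refine .ex <| (DPred.idxLe φ hlt (.var _) (.var _)).and <|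
    (DPred.lt φ (.var _) (.const _)).and <| .and (.all ?_)
      (DPred.eq φ (.const _) (.add φ (.var _) (.var _)))
  exact (DPred.idxLe φ hlt (.var _) (.var _)).imp <|
    (DPred.lt φ (.var _) (.const _)).imp (DPred.le φ (.var _) (.var _))

theorem DPred.record (φ : addLt.LHom L) [φ.IsExpansionOn ℝ]
    (hlt : DPred L fun w : Fin 2 → ℝ => IdxLt q (w 0) (w 1)) (x : ℝ) {t : (α → ℝ) → ℝ}
    (ht : DTerm L t) : DPred L fun w => Record q x (t w) := by
  refine DPred.rel₁ (R := Record q x) ?_ ht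
  unfold Record
  refine (DPred.idxLe φ hlt (.var _) (.var _)).and <|
    (DPred.lt φ (.var _) (.const _)).and <| .all ?_
  exact (DPred.idxLe φ hlt (.var _) (.var _)).imp <|
    (DPred.lt φ (.var _) (.const _)).imp (DPred.le φ (.var _) (.var _))

theorem DPred.blockStart (φ : addLt.LHom L) [φ.IsExpansionOn ℝ]
    (hlt : DPred L fun w : Fin 2 → ℝ => IdxLt q (w 0) (w 1)) (x b₀ b₁ : ℝ) {t : (α → ℝ) → ℝ}
    (ht : DTerm L t) : DPred L fun w => BlockStart q x b₀ b₁ (t w) := by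
  refine DPred.rel₁ (R := BlockStart q x b₀ b₁) ?_ ht
  unfold BlockStart
  exact (DPred.record φ hlt _ (.var _)).and <| .ex <| .ex <|
    (DPred.offset φ hlt _ (.var _) (.var _)).and <|
    (DPred.offset φ hlt _ (.var _) (.var _)).and (DPred.lt φ (.var _) (.var _))

theorem DPred.fitsAt (φ : addLt.LHom L) [φ.IsExpansionOn ℝ]
    (hlt : DPred L fun w : Fin 2 → ℝ => IdxLt q (w 0) (w 1)) {f : ℝ → ℝ} {I : Set ℝ}
    (hf : DefinableFunOn L f I) (g : Fin 4 → ℝ) {t t' : (α → ℝ) → ℝ}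
    (ht : DTerm L t) (ht' : DTerm L t') : DPred L fun w => FitsAt q f I g (t w) (t' w) := by
  -- Only the graph of `f` is definable, so the values of `f` become quantified variables.
  have hfits : ∀ z ε α β γ, Fits f I z ε α β γ ↔ ∃ y, ∃ y', (z ∈ I ∧ y = f z) ∧
      (z + ε ∈ I ∧ y' = f (z + ε)) ∧ y + α < y' + β ∧ y' + β < y + α + γ := by
    intro z ε α β γ
    constructor
    · rintro ⟨h1, h2, h3, h4⟩
      exact ⟨_, _, ⟨h1, rfl⟩, ⟨h2, rfl⟩, h3, h4⟩
    · rintro ⟨_, _, ⟨h1, rfl⟩, ⟨h2, rfl⟩, h3, h4⟩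
      exact ⟨h1, h2, h3, h4⟩
  refine DPred.rel₂ (R := FitsAt q f I g) ?_ ht ht'
  simp only [FitsAt, hfits]
  refine .ex <| .ex <| .ex <| .ex <|
    (DPred.offset φ hlt _ (.var _) (.var _)).and <|
    (DPred.offset φ hlt _ (.var _) (.var _)).and <|
    (DPred.offset φ hlt _ (.var _) (.var _)).and <|
    (DPred.offset φ hlt _ (.var _) (.var _)).and <| .ex <| .ex <| ?_
  refine (DPred.rel₂ (R := fun z y => z ∈ I ∧ y = f z) hf (.var _) (.var _)).and <|
    (DPred.rel₂ (R := fun z y => z ∈ I ∧ y = f z) hf (.add φ (.var _) (.var _)) (.var _)).and <|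
    (DPred.lt φ (.add φ (.var _) (.var _)) (.add φ (.var _) (.var _))).and
      (DPred.lt φ (.add φ (.var _) (.var _)) (.add φ (.add φ (.var _) (.var _)) (.var _)))

theorem DPred.fitsBlock (φ : addLt.LHom L) [φ.IsExpansionOn ℝ]
    (hlt : DPred L fun w : Fin 2 → ℝ => IdxLt q (w 0) (w 1)) {f : ℝ → ℝ} {I : Set ℝ}
    (hf : DefinableFunOn L f I) (x b₀ b₁ : ℝ) (g : Fin 4 → ℝ) {t t' : (α → ℝ) → ℝ}
    (ht : DTerm L t) (ht' : DTerm L t') :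
    DPred L fun w => FitsBlock q f I x b₀ b₁ g (t w) (t' w) := by
  refine DPred.rel₂ (R := FitsBlock q f I x b₀ b₁ g) ?_ ht ht'
  unfold FitsBlock
  refine .all <| (DPred.record φ hlt _ (.var _)).imp <|
    (DPred.idxLe φ hlt (.var _) (.var _)).imp <| .imp (.all ?_)
    (DPred.fitsAt φ hlt hf _ (.var _) (.var _))
  exact (DPred.record φ hlt _ (.var _)).imp <| (DPred.rel₂ hlt (.var _) (.var _)).imp <|
    (DPred.idxLe φ hlt (.var _) (.var _)).imp (DPred.blockStart φ hlt _ _ _ (.var _)).not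

theorem DPred.encodes (φ : addLt.LHom L) [φ.IsExpansionOn ℝ]
    (hlt : DPred L fun w : Fin 2 → ℝ => IdxLt q (w 0) (w 1)) {f : ℝ → ℝ} {I : Set ℝ}
    (hf : DefinableFunOn L f I) (x b₀ b₁ : ℝ) (g : Fin 4 → ℝ) {t t' : (α → ℝ) → ℝ}
    (ht : DTerm L t) (ht' : DTerm L t') :
    DPred L fun w => Encodes q f I x b₀ b₁ g (t w) (t' w) := by
  refine DPred.rel₂ (R := Encodes q f I x b₀ b₁ g) ?_ ht ht'
  unfold Encodes
  exact (DPred.idxLe φ hlt (.var _) (.var _)).and <|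
    (DPred.fitsBlock φ hlt hf _ _ _ _ (.var _) (.var _)).and <| .all <|
    (DPred.rel₂ hlt (.var _) (.var _)).imp
      (DPred.fitsBlock φ hlt hf _ _ _ _ (.var _) (.var _)).not

end Definability

/-! ### Compact sets as definable cluster sets. -/

section Compact

/-- A nonempty compact set is the set of cluster points of a sequence of tuples of points of an
affine image of a given dense sequence. -/
theorem exists_cluster_sequence {q : ℕ → ℝ} {c d : ℝ} (hcd : c < d)
    (hdense : ∀ u v, c ≤ u → u < v → v ≤ d → ∃ n, q n ∈ Ioo u v) {k : ℕ}
    {X : Set (Fin k → ℝ)} (hX : IsCompact X) (hne : X.Nonempty) :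
    ∃ (M : ℕ) (τ : ℝ) (p : ℕ → Fin k → ℕ), ∀ z, z ∈ X ↔ ∀ ρ > 0, ∀ n₁, ∃ n > n₁, ∀ j,
      z j + τ < M • q (p n j) + ρ ∧ M • q (p n j) < z j + τ + ρ := by
  obtain ⟨R, hR⟩ := hX.isBounded.exists_norm_le
  -- Multiplication by a natural number is repeated addition, hence definable; this `M` stretches
  -- `(c, d)` enough to cover the bounded set after translation by `τ`.
  obtain ⟨M, hM⟩ := exists_nat_gt (2 * (|R| + 1) / (d - c))
  have hdc : 0 < d - c := sub_pos.2 hcd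
  have hM' : |R| + 1 < M * ((d - c) / 2) := by
    rw [div_lt_iff₀ hdc] at hM
    linarith
  have hM0 : (0 : ℝ) < M := lt_of_le_of_lt (by positivity) hM
  obtain ⟨τ, hτ⟩ : ∃ τ, τ = M * ((c + d) / 2) := ⟨_, rfl⟩
  have happrox : ∀ r, |r| ≤ |R| → ∀ ρ > 0, ∃ i, r + τ < M * q i + ρ ∧ M * q i < r + τ + ρ := by
    intro r hr ρ hρ
    obtain ⟨h1, h2⟩ := abs_le.1 hr
    have hr1 : c < (r + τ) / M := by
      rw [lt_div_iff₀ hM0]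
      linarith
    have hr2 : (r + τ) / M < d := by
      rw [div_lt_iff₀ hM0]
      linarith
    obtain ⟨i, hi⟩ := hdense ((r + τ) / M) (min d ((r + τ + ρ) / M)) hr1.le
      (lt_min hr2 (div_lt_div_of_pos_right (by linarith) hM0)) (min_le_left _ _)
    have h3 := (div_lt_iff₀ hM0).1 hi.1
    have h4 := (lt_div_iff₀ hM0).1 (hi.2.trans_le (min_le_right _ _))
    exact ⟨i, by linarith, by linarith⟩
  have : Nonempty X := hne.to_subtype
  -- Unpairing repeats every term of the dense sequence infinitely often, so isolated points of `X`
  -- are cluster points too.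
  let ζ : ℕ → Fin k → ℝ := fun n => (TopologicalSpace.denseSeq X n.unpair.1 : X)
  have hζ : ∀ n, ζ n ∈ X := fun n => Subtype.mem _
  choose p hp using fun n j => happrox (ζ n j)
    (((norm_le_pi_norm (ζ n) j).trans (hR _ (hζ n))).trans (le_abs_self R)) (1 / (n + 1))
    Nat.one_div_pos_of_nat
  refine ⟨M, τ, p, fun z => ⟨fun hz ρ hρ n₁ => ?_, fun h => ?_⟩⟩
  · obtain ⟨n₂, hn₂⟩ := exists_nat_one_div_lt (half_pos hρ)
    obtain ⟨m, hm⟩ := (TopologicalSpace.denseRange_denseSeq X).exists_dist_lt ⟨z, hz⟩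
      (half_pos hρ)
    have hle := Nat.right_le_pair m (n₁ + n₂ + 1)
    refine ⟨Nat.pair m (n₁ + n₂ + 1), by omega, fun j => ?_⟩
    have h1 := hp (Nat.pair m (n₁ + n₂ + 1)) j
    have h2 : (1 : ℝ) / ((Nat.pair m (n₁ + n₂ + 1) : ℕ) + 1) ≤ 1 / (n₂ + 1) :=
      Nat.one_div_le_one_div (by omega)
    have h3 : |z j - ζ (Nat.pair m (n₁ + n₂ + 1)) j| < ρ / 2 := by
      rw [← Real.dist_eq]
      refine (dist_le_pi_dist z _ j).trans_lt ?_
      simp only [ζ, Nat.unpair_pair]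
      exact hm
    rw [abs_lt] at h3
    simp only [nsmul_eq_mul]
    constructor <;> linarith [h1.1, h1.2, h3.1, h3.2]
  · rw [← hX.isClosed.closure_eq]
    refine Metric.mem_closure_iff.2 fun ρ hρ => ?_
    obtain ⟨n₂, hn₂⟩ := exists_nat_one_div_lt (half_pos hρ)
    obtain ⟨n, hn, hz⟩ := h (ρ / 2) (half_pos hρ) n₂
    refine ⟨ζ n, hζ n, (dist_pi_lt_iff hρ).2 fun j => ?_⟩
    have h1 := hp n j
    have h2 : (1 : ℝ) / (n + 1) ≤ 1 / (n₂ + 1) := Nat.one_div_le_one_div hn.le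
    have h3 := hz j
    simp only [nsmul_eq_mul] at h3
    rw [Real.dist_eq, abs_lt]
    constructor <;> linarith [h1.1, h1.2, h3.1, h3.2]

variable {L : FirstOrder.Language.{u, v}} [L.Structure ℝ]

/-- A dense definable enumeration together with a definable continuous function whose increments
at any two points differ for arbitrarily small arguments defines every compact set. -/
theorem definableSet_of_isCompact (φ : addLt.LHom L) [φ.IsExpansionOn ℝ] {f : ℝ → ℝ} {c d : ℝ}
    (hcd : c < d) (hdef : DefinableFunOn L f (Ioo c d)) (hf : ContinuousOn f (Ioo c d))
    (hsep : ∀ x ∈ Ioo c d, ∀ y ∈ Ioo c d, x < y → ∀ δ > 0,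
      ∃ ε ∈ Ioo 0 δ, f (x + ε) - f x ≠ f (y + ε) - f y)
    {q : ℕ → ℝ} (hq : ∀ n, q n ∈ Ioo c d) (hinj : Function.Injective q)
    (hdense : ∀ u v, c ≤ u → u < v → v ≤ d → ∃ n, q n ∈ Ioo u v)
    (hlt : DPred L fun w : Fin 2 → ℝ => IdxLt q (w 0) (w 1)) {k : ℕ} {X : Set (Fin k → ℝ)}
    (hX : IsCompact X) : DefinableSet L X := by
  rcases X.eq_empty_or_nonempty with rfl | hne
  · exact Set.definable_empty
  obtain ⟨M, τ, p, hp⟩ := exists_cluster_sequence hcd hdense hX hne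
  obtain ⟨x, b₀, b₁, g, n₀, s, hs, hn₀, hstart, henc⟩ :=
    exists_encoding hf hsep hq hinj hdense p
  -- Enumerated points replace natural numbers as bounds: `u` plays the role of `n₁`, and the block
  -- start `u'` that of `n`.
  have hiff : X = {z | ∀ ρ, 0 < ρ → ∀ u, IdxLe q u u → ∃ u', IdxLt q u u' ∧
      BlockStart q x b₀ b₁ u' ∧ ∀ j, ∃ e, Encodes q f (Ioo c d) x b₀ b₁ (g j) u' e ∧
        z j + τ < M • e + ρ ∧ M • e < z j + τ + ρ} := by
    ext z
    rw [hp, Set.mem_ofPred_eq]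
    constructor
    · rintro h ρ hρ _ ⟨i, _, -, rfl, -⟩
      obtain ⟨n, hn, hz⟩ := h ρ hρ i
      exact ⟨q (s n), (idxLt_iff hinj).2 (hn.trans_le (hs.id_le n)),
        (hstart _ (hn₀ n)).2 ⟨n, rfl⟩, fun j => ⟨_, (henc n j _).2 rfl, hz j⟩⟩
    · intro h ρ hρ n₁
      -- The threshold `q (s n₁)` lies past `n₀`, so `u'` is a genuine block start, and its block
      -- number exceeds `n₁`.
      obtain ⟨u', hlt', hu', hz⟩ := h ρ hρ (q (s n₁)) ((idxLe_iff hinj).2 le_rfl)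
      obtain ⟨m, rfl⟩ := hu'.1.exists_eq
      have hm := (idxLt_iff hinj).1 hlt'
      obtain ⟨n, rfl⟩ := (hstart m ((hn₀ n₁).trans hm)).1 hu'
      refine ⟨n, hs.lt_iff_lt.1 hm, fun j => ?_⟩
      obtain ⟨e, he, hze⟩ := hz j
      obtain rfl := (henc n j e).1 he
      exact hze
  rw [hiff]
  change DPred L _
  refine .all <| (DPred.lt φ (.const _) (.var _)).imp <| .all <|
    (DPred.idxLe φ hlt (.var _) (.var _)).imp <| .ex <|
    (DPred.rel₂ hlt (.var _) (.var _)).and <| (DPred.blockStart φ hlt _ _ _ (.var _)).and <|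
    .forall_finite fun j => .ex <|
    (DPred.encodes φ hlt hdef _ _ _ _ (.var _) (.var _)).and <| .and ?_ ?_
  · exact DPred.lt φ (.add φ (.var _) (.const _)) (.add φ (.nsmul φ (.var _) M) (.var _))
  · exact DPred.lt φ (.nsmul φ (.var _) M) (.add φ (.add φ (.var _) (.const _)) (.var _))

end Compact

end RealExpansion

open RealExpansion in
theorem theoremD (L : FirstOrder.Language.{u, v}) [L.Structure ℝ]
    (φ : RealExpansion.addLt.LHom L) [φ.IsExpansionOn ℝ]
    (hB : RealExpansion.IsTypeB L)
    (a b : ℝ) (hab : a < b) (f : ℝ → ℝ)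
    (hdef : RealExpansion.DefinableFunOn L f (Set.Ioo a b))
    (hcont : ContinuousOn f (Set.Ioo a b)) :
    RealExpansion.Repetitious f a b := by
  by_contra hrep
  obtain ⟨⟨D, hD, hdense⟩, k, X, hX, hXdef⟩ := hB
  simp only [Repetitious, not_forall] at hrep
  obtain ⟨c₀, d₀, hcd₀, hsub₀, hrep⟩ := hrep
  obtain ⟨c, d, q, hcd, hsub, hq, hinj, hqdense, hlt⟩ := exists_dense_enumeration φ hD hdense hcd₀
  have hJ : Ioo c d ⊆ Ioo a b := hsub.trans hsub₀
  refine hXdef (definableSet_of_isCompact φ hcd (f := f) ?_ (hcont.mono hJ) ?_ hq hinj hqdense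
    hlt hX)
  · have hiff : ∀ w : Fin 2 → ℝ, (w 0 ∈ Ioo c d ∧ w 1 = f (w 0)) ↔
        w 0 ∈ Ioo c d ∧ (w 0 ∈ Ioo a b ∧ w 1 = f (w 0)) :=
      fun w => ⟨fun h => ⟨h.1, hJ h.1, h.2⟩, fun h => ⟨h.1, h.2.2⟩⟩
    unfold DefinableFunOn
    simp only [hiff]
    exact DPred.and (DPred.mem_Ioo φ (.var 0) c d) hdef
  · intro x hx y hy hxy δ hδ
    by_contra! hall
    -- Half of this minimum is a witness for repetitiousness: it is strictly below `y - x`, and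
    -- shifts by less than it keep both points in `(c, d)`.
    have hpos : 0 < min δ (min (y - x) (d - y)) :=
      lt_min hδ (lt_min (sub_pos.2 hxy) (sub_pos.2 hy.2))
    have hle : min δ (min (y - x) (d - y)) ≤ δ ∧ min δ (min (y - x) (d - y)) ≤ y - x ∧
        min δ (min (y - x) (d - y)) ≤ d - y :=
      ⟨min_le_left _ _, (min_le_right _ _).trans (min_le_left _ _),
        (min_le_right _ _).trans (min_le_right _ _)⟩
    obtain ⟨h1, h2, h3⟩ := hle
    refine hrep ⟨min δ (min (y - x) (d - y)) / 2, half_pos hpos, x, hsub hx, y, hsub hy,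
      by linarith, fun ε h0 hε => ⟨hJ ⟨?_, ?_⟩, hJ ⟨?_, ?_⟩, ?_⟩⟩
    · linarith [hx.1]
    · linarith [hy.2]
    · linarith [hy.1]
    · linarith
    · rcases h0.eq_or_lt with rfl | h0
      · simp
      · exact hall ε ⟨h0, by linarith⟩
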